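/- For $n\in\mathbb{N}=\{0,1,2,\dots\}$ let $b(n)$ be the number of partitions of $n$ into powers of $2$ (so $b(0)=1$), and for $m\ge 1$ let $$b_m(n)=\sum_{i_1+\cdots+i_m=n} b(i_1)\cdots b(i_m),$$ the sum being over all $(i_1,\dots,i_m)\in\mathbb{N}^m$ with $i_1+\cdots+i_m=n$; that is, $b_m(n)$ is the number of partitions of $n$ into powers of $2$ in which each part has one of $m$ colours. Let $t_n=(-1)^{s_2(n)}$ be the Prouhet–Thue–Morse sequence, where $s_2(n)$ is the sum of the binary digits of $n$, and let $\nu_2$ denote the $2$-adic valuation. A number is called a sum of three squares if it equals $x^2+y^2+z^2$ for some $x,y,z\in\mathbb{Z}$. Let $k\ge 3$ and $n\ge 0$ be integers. 1. If $n\ge 2^k$, then the following conditions are equivalent: (a) $b_{2^k-1}(n)$ is not a sum of three squares; (b) $t_n=t_{n-2^k}=1$; (c) $n=2^k m+l$ for some $l,m\in\mathbb{N}$ such that $l<2^k$, $t_m=t_l$, and $\nu_2(m)$ is odd. 2. If $n<2^k$, then $b_{2^k-1}(n)$ is not a sum of three squares if and only if one of the following holds: (i) $0\le n<2^{k-2}$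 and $t_n=-1$; (ii) $2^{k-1}\le n<3\cdot 2^{k-2}$ and $t_n=1$. -/

import Mathlib

/-- The binary partition function `b n`: the number of partitions of `n` all of whose parts
are powers of two. -/
def binaryPartition (n : ℕ) : ℕ :=
  (Nat.Partition.restricted n Nat.isPowerOfTwo).card

/-- The `m`-coloured binary partition function, the convolution of `m` copies of `b`:
`b_m n = ∑ b i₁ * ⋯ * b iₘ` over all `m`-tuples of natural numbers with `i₁ + ⋯ + iₘ = n`. -/
def colouredBinaryPartition (m n : ℕ) : ℕ :=
  ∑ i ∈ Finset.Nat.antidiagonalTuple m n, ∏ j : Fin m, binaryPartition (i j)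

/-- The Prouhet–Thue–Morse sequence with values `1` and `-1`: `t n = (-1) ^ s₂ n`, where
`s₂ n` is the sum of the binary digits of `n`. -/
def thueMorse (n : ℕ) : ℤ :=
  (-1) ^ (Nat.digits 2 n).sum

/-- `N` is a sum of three squares of integers. -/
def IsSumOfThreeSquares (N : ℕ) : Prop :=
  ∃ x y z : ℤ, (N : ℤ) = x ^ 2 + y ^ 2 + z ^ 2

/-!
The generating function of the binary partition function is `B = 1 / T`, where
`T = ∏ (1 - X ^ 2 ^ a) = ∑ t n X ^ n` is the generating function of the Prouhet–Thue–Morse sequence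
(`binaryPartitionSeries_mul_thueMorseSeries`). Hence `b_{2 ^ k - 1}` has the generating function
`B ^ (2 ^ k - 1) = T * B ^ 2 ^ k`. Since `B ≡ 1 + X` modulo `2`, `B ^ 2 ^ j ≡ 1 + X ^ 2 ^ j` modulo
`2`, and raising to the power `2 ^ i` gives
`B ^ 2 ^ (j + i) ≡ (1 + X ^ 2 ^ j) ^ 2 ^ i` modulo `2 ^ (i + 1)` (`two_pow_dvd_coeff_sub`).

For `n < 2 ^ k` take `i = 2`: modulo `8`, `b_{2 ^ k - 1}(n)` is a combination of at most four values
of `t` at distance `2 ^ (k - 2)`, hence odd, and it is `7` exactly in the listed cases. For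
`n = 2 ^ k m + L` with `m ≥ 1` and `L < 2 ^ k` take `i = 4`: modulo `32` only
the signs `t m`, `t (m - 1)`, `t L` and the leading digits of `L` matter. If `t m = t (m - 1)`, the
value is `28 t m t L` modulo `32`, otherwise it is `2` modulo `4`. For `k = 3` the exponent `i = 4`
is not available; `thirtyTwo_dvd_coeff_seven_sub` shows that `T (1 + X) ^ 8` is still correct modulo
`32` in degrees at least `8`. The condition `t m = t (m - 1)` says that the `2`-adic valuation of `m`
is odd (`thueMorse_succ_eq_iff`).

In all cases `16` does not divide `b_{2 ^ k - 1}(n)`, so by the three squares theorem the value is not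
a sum of three squares exactly if it is `7` modulo `8` or `28` modulo `32`
(`isSumOfThreeSquares_iff_of_mod_sixteen_ne_zero`). The three squares theorem is proved in the
classical way: a positive definite integral ternary form of determinant one is equivalent to
`x² + y² + z²`, and Dirichlet's theorem on primes with quadratic reciprocity provides such a form
that represents the given number.
-/

/-! ### Positive definite ternary forms of determinant one -/

/-- The integer nearest to `m / d`. -/
theorem Int.exists_abs_two_mul_sub_mul_le (m : ℤ) {d : ℤ} (hd : 0 < d) :
    ∃ k : ℤ, |2 * (m - k * d)| ≤ d := by
  refine ⟨(2 * m + d) / (2 * d), ?_⟩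
  have h1 := Int.mul_ediv_add_emod (2 * m + d) (2 * d)
  have h2 := Int.emod_nonneg (2 * m + d) (b := 2 * d) (by omega)
  have h3 := Int.emod_lt_of_pos (2 * m + d) (b := 2 * d) (by omega)
  rw [abs_le]
  constructor <;> linarith

/-- Every value of a positive definite integral ternary form
`a x² + 2 h x y + 2 g x z + b y² + 2 f y z + c z²` of determinant one is a sum of three squares.
The form is changed by unimodular substitutions until it is `x² + y² + z²`: either the leading
coefficient `a`, or for fixed `a` the minor `a b - h²`, can be decreased, or Hermite's inequalities
force both to be `1`. -/
theorem exists_sum_three_sq_of_ternary_det_eq_one (a h g b f c : ℤ) (ha : 0 < a)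
    (hG : 0 < a * b - h ^ 2)
    (hdet : a * (b * c - f ^ 2) - h * (h * c - f * g) + g * (h * f - b * g) = 1) (x y z : ℤ) :
    ∃ u v w : ℤ, a * x ^ 2 + 2 * h * x * y + 2 * g * x * z + b * y ^ 2 + 2 * f * y * z + c * z ^ 2
      = u ^ 2 + v ^ 2 + w ^ 2 := by
  obtain ⟨k, hk⟩ := Int.exists_abs_two_mul_sub_mul_le (a * f - g * h) hG
  -- Replace `y` by `y - k z`, which makes the off-diagonal entry of the adjugate small.
  obtain ⟨g', hg'⟩ : ∃ g', g' = g - k * h := ⟨_, rfl⟩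
  obtain ⟨f', hf'⟩ : ∃ f', f' = f - k * b := ⟨_, rfl⟩
  obtain ⟨c', hc'⟩ : ∃ c', c' = c - 2 * k * f + k ^ 2 * b := ⟨_, rfl⟩
  have hdet' : a * (b * c' - f' ^ 2) - h * (h * c' - f' * g') + g' * (h * f' - b * g') = 1 := by
    subst hg' hf' hc'; linear_combination hdet
  have hk' : |2 * (a * f' - g' * h)| ≤ a * b - h ^ 2 := by
    convert hk using 2; subst hg' hf'; ring
  have hval : a * x ^ 2 + 2 * h * x * y + 2 * g * x * z + b * y ^ 2 + 2 * f * y * z + c * z ^ 2 =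
      a * x ^ 2 + 2 * h * x * (y + k * z) + 2 * g' * x * z + b * (y + k * z) ^ 2
        + 2 * f' * (y + k * z) * z + c' * z ^ 2 := by
    subst hg' hf' hc'; ring
  have hminors : (a * b - h ^ 2) * (a * c' - g' ^ 2) = a + (a * f' - g' * h) ^ 2 := by
    linear_combination a * hdet'
  have hG22 : 0 < a * c' - g' ^ 2 := by
    refine pos_of_mul_pos_right (a := a * b - h ^ 2) ?_ hG.le
    rw [hminors]; positivity
  by_cases hlt : a * c' - g' ^ 2 < a * b - h ^ 2
  · obtain ⟨u, v, w, e⟩ := exists_sum_three_sq_of_ternary_det_eq_one a g' h c' f' b ha hG22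
      (by linear_combination hdet') x z (y + k * z)
    exact ⟨u, v, w, by rw [hval, ← e]; ring⟩
  have hsq : 4 * (a * f' - g' * h) ^ 2 ≤ (a * b - h ^ 2) ^ 2 := by
    have := sq_le_sq' (abs_le.mp hk').1 (abs_le.mp hk').2
    linarith
  have hHermite₂ : 3 * (a * b - h ^ 2) ^ 2 ≤ 4 * a := by
    have := mul_le_mul_of_nonneg_left (not_lt.mp hlt) hG.le
    linarith [sq (a * b - h ^ 2)]
  -- Replace `x` by `x - k₂ y`, which makes `h` small.
  obtain ⟨k₂, hk₂⟩ := Int.exists_abs_two_mul_sub_mul_le h ha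
  obtain ⟨h', hh'⟩ : ∃ h', h' = h - k₂ * a := ⟨_, rfl⟩
  obtain ⟨b', hb'⟩ : ∃ b', b' = b - 2 * k₂ * h + k₂ ^ 2 * a := ⟨_, rfl⟩
  obtain ⟨f'', hf''⟩ : ∃ f'', f'' = f' - k₂ * g' := ⟨_, rfl⟩
  have hGeq : a * b' - h' ^ 2 = a * b - h ^ 2 := by subst hh' hb'; ring
  have hG12 : a * f'' - g' * h' = a * f' - g' * h := by subst hh' hf''; ring
  have hdet'' : a * (b' * c' - f'' ^ 2) - h' * (h' * c' - f'' * g') + g' * (h' * f'' - b' * g')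
      = 1 := by
    subst hh' hb' hf''; linear_combination hdet'
  rw [← hh'] at hk₂
  rw [← hGeq] at hG hHermite₂ hminors
  have hval' : a * x ^ 2 + 2 * h * x * y + 2 * g * x * z + b * y ^ 2 + 2 * f * y * z + c * z ^ 2 =
      a * (x + k₂ * (y + k * z)) ^ 2 + 2 * h' * (x + k₂ * (y + k * z)) * (y + k * z)
        + 2 * g' * (x + k₂ * (y + k * z)) * z + b' * (y + k * z) ^ 2
        + 2 * f'' * (y + k * z) * z + c' * z ^ 2 := by
    rw [hval]; subst hh' hb' hf''; ring
  have hb'pos : 0 < b' := by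
    refine pos_of_mul_pos_right (a := a) ?_ ha.le
    linarith [sq_nonneg h']
  by_cases hlt' : b' < a
  · obtain ⟨u, v, w, e⟩ := exists_sum_three_sq_of_ternary_det_eq_one b' h' f'' a g' c' hb'pos
      (by linarith) (by linear_combination hdet'') (y + k * z) (x + k₂ * (y + k * z)) z
    exact ⟨u, v, w, by rw [hval', ← e]; ring⟩
  have hsq' : 4 * h' ^ 2 ≤ a ^ 2 := by
    have := sq_le_sq' (abs_le.mp hk₂).1 (abs_le.mp hk₂).2
    linarith
  have hHermite₁ : 3 * a ^ 2 ≤ 4 * (a * b' - h' ^ 2) := by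
    have := mul_le_mul_of_nonneg_left (not_lt.mp hlt') ha.le
    linarith [sq a]
  -- The two inequalities give `27 a³ ≤ 64`.
  have ha1 : a = 1 := by
    by_contra hne
    have ha2 : 2 ≤ a := by omega
    obtain ⟨G, hGdef⟩ : ∃ G, G = a * b' - h' ^ 2 := ⟨_, rfl⟩
    rw [← hGdef] at hHermite₁ hHermite₂
    have h6 : 3 * a ≤ 2 * G := by nlinarith only [ha2, hHermite₁]
    nlinarith only [ha2, h6, hHermite₂]
  subst ha1
  have hG1 : 1 * b' - h' ^ 2 = 1 := by
    obtain ⟨G, hGdef⟩ : ∃ G, G = 1 * b' - h' ^ 2 := ⟨_, rfl⟩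
    rw [← hGdef] at hG hHermite₂ ⊢
    nlinarith only [hG, hHermite₂]
  have hh0 : h' = 0 := by
    have := abs_le.mp hk₂
    omega
  have hf0 : f'' = 0 := by
    rw [← hG12, ← hGeq, hG1, hh0] at hk'
    have := abs_le.mp hk'
    omega
  subst hh0 hf0
  have hb1 : b' = 1 := by linarith
  subst hb1
  exact ⟨x + k₂ * (y + k * z) + g' * z, y + k * z, z, by
    rw [hval']; linear_combination (z ^ 2) * hdet''⟩
termination_by (a.toNat, (a * b - h ^ 2).toNat)
decreasing_by
  · exact Prod.Lex.right _ (by omega)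
  · exact Prod.Lex.left _ _ (by omega)

/-! ### The three squares theorem -/

/-- If `-d` is a square modulo `d n - 1`, then `n` is a value of a positive definite ternary form of
determinant one. -/
theorem isSumOfThreeSquares_of_neg_sq {n d : ℕ} (hd : 0 < d) (hdn : 1 < d * n) {r : ℤ}
    (hr : (d * n - 1 : ℤ) ∣ r ^ 2 + d) : IsSumOfThreeSquares n := by
  obtain ⟨a, ha⟩ := hr
  have hdn' : (1 : ℤ) < d * n := by exact_mod_cast hdn
  have hd' : (0 : ℤ) < d := by exact_mod_cast hd
  have ha0 : 0 < a := by
    refine pos_of_mul_pos_right (a := (d * n - 1 : ℤ)) ?_ (by linarith)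
    rw [← ha]; positivity
  obtain ⟨u, v, w, e⟩ := exists_sum_three_sq_of_ternary_det_eq_one a r 1 (d * n - 1) 0 n ha0
    (by linarith) (by linear_combination (-(n : ℤ)) * ha) 0 0 1
  exact ⟨u, v, w, by rw [← e]; ring⟩

open NumberTheorySymbols in
theorem isSumOfThreeSquares_of_mod_four_eq_two {n : ℕ} (hn : n % 4 = 2) :
    IsSumOfThreeSquares n := by
  -- Dirichlet's theorem gives a prime `p = (4 j + 1) n - 1`; the determinant is `d = 4 j + 1`.
  obtain ⟨p, hpn, hp, hmod⟩ := Nat.forall_exists_prime_gt_and_modEq n (q := 4 * n) (a := n - 1)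
    (by omega) (by
      refine Nat.Coprime.mul_right ?_ ?_
      · have : Odd (n - 1) := Nat.odd_iff.mpr (by omega)
        exact (Nat.Coprime.pow_right 2 (Nat.coprime_two_right.mpr this) : Nat.Coprime _ (2 ^ 2))
      · exact (Nat.coprime_self_sub_left (by omega)).mpr (by simp))
  obtain ⟨j, hj⟩ := (Nat.modEq_iff_dvd' (by omega)).mp hmod.symm
  have hpj : p + 1 = (4 * j + 1) * n := by
    have : p = 4 * n * j + (n - 1) := by omega
    rw [this, add_assoc, Nat.sub_add_cancel (by omega)]; ring
  have := Fact.mk hp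
  have hp4 : p % 4 = 1 := by
    have : (p + 1) % 4 = ((4 * j + 1) % 4 * (n % 4)) % 4 := by rw [hpj, Nat.mul_mod]
    rw [hn] at this
    omega
  have hpodd : Odd p := Nat.odd_iff.mpr (by omega)
  have hdodd : Odd (4 * j + 1) := ⟨2 * j, by ring⟩
  have hJ : J(-((4 * j + 1 : ℕ) : ℤ) | p) = 1 := by
    rw [jacobiSym.neg _ hpodd, ZMod.χ₄_nat_one_mod_four hp4, one_mul,
      jacobiSym.quadratic_reciprocity_one_mod_four' hdodd hp4,
      jacobiSym.mod_left' (a₂ := -1), jacobiSym.at_neg_one hdodd,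
      ZMod.χ₄_nat_one_mod_four (by omega)]
    refine Int.ModEq.symm (Int.modEq_iff_dvd.mpr ⟨n, ?_⟩)
    have : (p : ℤ) + 1 = ((4 * j + 1 : ℕ) : ℤ) * n := by exact_mod_cast hpj
    linarith
  obtain ⟨s, hs⟩ := ZMod.isSquare_of_jacobiSym_eq_one hJ
  refine isSumOfThreeSquares_of_neg_sq (d := 4 * j + 1) (r := (s.val : ℤ)) (by omega)
    (by rw [← hpj]; have := hp.pos; omega) ?_
  have hpe : (((4 * j + 1 : ℕ) : ℤ) * n - 1) = p := by
    have : (p : ℤ) + 1 = ((4 * j + 1 : ℕ) : ℤ) * n := by exact_mod_cast hpj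
    linarith
  rw [hpe, ← ZMod.intCast_zmod_eq_zero_iff_dvd]
  push_cast at hs ⊢
  rw [ZMod.natCast_zmod_val, sq, ← hs]
  ring

open NumberTheorySymbols in
/-- A residue `c` with the listed properties turns a prime `p = 4 n j + (c n - 1) / 2` into a
determinant `d = 8 j + c` with `2 p = d n - 1` such that `-d` is a square modulo `2 p`. -/
theorem isSumOfThreeSquares_of_odd {n c : ℕ} (hn : 0 < n) (hc : Odd c) (hc1 : 1 < c * n)
    (h4 : (c * n - 1) % 4 = 2)
    (hcase : ∀ d p : ℕ, d % 8 = c % 8 → p % 4 = (c * n - 1) / 2 % 4 → d * n = 2 * p + 1 →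
      J(-(d : ℤ) | p) = 1) :
    IsSumOfThreeSquares n := by
  obtain ⟨e, he⟩ : ∃ e, c * n = 2 * e + 1 := ⟨(c * n - 1) / 2, by omega⟩
  have he2 : (c * n - 1) / 2 = e := by omega
  have heodd : Odd e := Nat.odd_iff.mpr (by omega)
  obtain ⟨p, hpn, hp, hmod⟩ := Nat.forall_exists_prime_gt_and_modEq (e + 2) (q := 4 * n) (a := e)
    (by omega) (by
      refine Nat.Coprime.mul_right ?_ ?_
      · exact (Nat.Coprime.pow_right 2 (Nat.coprime_two_right.mpr heodd) : Nat.Coprime _ (2 ^ 2))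
      · refine Nat.Coprime.coprime_dvd_right (Dvd.intro_left c rfl) ?_
        rw [he]; simp)
  obtain ⟨j, hj⟩ := (Nat.modEq_iff_dvd' (by omega)).mp hmod.symm
  have hpj : p = 4 * n * j + e := by omega
  have hdn : (8 * j + c) * n = 2 * p + 1 := by
    rw [add_mul, he, hpj]; ring
  have := Fact.mk hp
  have hJ := hcase (8 * j + c) p (by omega) (by rw [he2, hpj, mul_assoc]; omega) hdn
  obtain ⟨s, hs⟩ := ZMod.isSquare_of_jacobiSym_eq_one hJ
  obtain ⟨i, hi⟩ := hc
  -- The root modulo `p` is made odd, so that it is a root modulo `2 p` as well.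
  obtain ⟨r, hr, hrodd⟩ : ∃ r : ℤ, (p : ℤ) ∣ r ^ 2 + (8 * j + c : ℕ) ∧ Odd r := by
    have h1 : (p : ℤ) ∣ (s.val : ℤ) ^ 2 + (8 * j + c : ℕ) := by
      rw [← ZMod.intCast_zmod_eq_zero_iff_dvd]
      push_cast at hs ⊢
      rw [ZMod.natCast_zmod_val, sq, ← hs]
      ring
    rcases Int.even_or_odd (s.val : ℤ) with h | h
    · refine ⟨s.val + p, ?_, h.add_odd ?_⟩
      · have : ((s.val : ℤ) + p) ^ 2 + (8 * j + c : ℕ)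
            = ((s.val : ℤ) ^ 2 + (8 * j + c : ℕ)) + p * (2 * s.val + p) := by ring
        rw [this]
        exact dvd_add h1 (dvd_mul_right _ _)
      · exact_mod_cast hp.odd_of_ne_two (by omega)
    · exact ⟨_, h1, h⟩
  refine isSumOfThreeSquares_of_neg_sq (d := 8 * j + c) (r := r) (by omega)
    (by have := hp.pos; omega) ?_
  have hpe : (((8 * j + c : ℕ) : ℤ) * n - 1) = 2 * p := by
    have : (((8 * j + c : ℕ) : ℤ) * n) = 2 * p + 1 := by exact_mod_cast hdn
    linarith
  rw [hpe]
  refine IsCoprime.mul_dvd ?_ ?_ hr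
  · have : Odd p := hp.odd_of_ne_two (by omega)
    exact Nat.isCoprime_iff_coprime.mpr (Nat.coprime_two_left.mpr this)
  · obtain ⟨q, rfl⟩ := hrodd
    refine ⟨2 * q ^ 2 + 2 * q + 1 + 4 * j + i, ?_⟩
    rw [hi]; push_cast; ring

open NumberTheorySymbols in
/-- `2 p ≡ -1` modulo `d`, in terms of Jacobi symbols. -/
theorem jacobiSym_two_mul_eq_of_mul_eq {d p n : ℕ} (h : d * n = 2 * p + 1) :
    J(2 | d) * J(p | d) = J(-1 | d) := by
  rw [← jacobiSym.mul_left]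
  refine jacobiSym.mod_left' ((Int.modEq_iff_dvd).mpr ⟨-n, ?_⟩)
  have : (d : ℤ) * n = 2 * p + 1 := by exact_mod_cast h
  linarith

theorem isSumOfThreeSquares_of_mod_eight_eq_three {n : ℕ} (hn : n % 8 = 3) :
    IsSumOfThreeSquares n := by
  refine isSumOfThreeSquares_of_odd (c := 1) (by omega) (by decide) (by omega) (by omega) ?_
  intro d p hd hp h
  have hdodd : Odd d := Nat.odd_iff.mpr (by omega)
  have hpodd : Odd p := Nat.odd_iff.mpr (by omega)
  have hp4 : p % 4 = 1 := by omega
  have key := jacobiSym_two_mul_eq_of_mul_eq h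
  rw [jacobiSym.at_two hdodd, jacobiSym.at_neg_one hdodd, ZMod.χ₄_nat_one_mod_four (by omega),
    ZMod.χ₈_nat_eq_if_mod_eight] at key
  rw [jacobiSym.neg _ hpodd, ZMod.χ₄_nat_one_mod_four hp4, one_mul,
      jacobiSym.quadratic_reciprocity_one_mod_four' hdodd hp4]
  rw [if_neg (by omega), if_pos (by omega)] at key
  linarith

theorem isSumOfThreeSquares_of_mod_eight_eq_one {n : ℕ} (hn : n % 8 = 1) :
    IsSumOfThreeSquares n := by
  refine isSumOfThreeSquares_of_odd (c := 3) (by omega) (by decide) (by omega) (by omega) ?_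
  intro d p hd hp h
  have hdodd : Odd d := Nat.odd_iff.mpr (by omega)
  have hpodd : Odd p := Nat.odd_iff.mpr (by omega)
  have hp4 : p % 4 = 1 := by omega
  have key := jacobiSym_two_mul_eq_of_mul_eq h
  rw [jacobiSym.at_two hdodd, jacobiSym.at_neg_one hdodd, ZMod.χ₄_nat_three_mod_four (by omega),
    ZMod.χ₈_nat_eq_if_mod_eight] at key
  rw [jacobiSym.neg _ hpodd, ZMod.χ₄_nat_one_mod_four hp4, one_mul,
      jacobiSym.quadratic_reciprocity_one_mod_four' hdodd hp4]
  rw [if_neg (by omega), if_neg (by omega)] at key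
  linarith

theorem isSumOfThreeSquares_of_mod_eight_eq_five {n : ℕ} (hn : n % 8 = 5) :
    IsSumOfThreeSquares n := by
  refine isSumOfThreeSquares_of_odd (c := 3) (by omega) (by decide) (by omega) (by omega) ?_
  intro d p hd hp h
  have hdodd : Odd d := Nat.odd_iff.mpr (by omega)
  have hpodd : Odd p := Nat.odd_iff.mpr (by omega)
  have hp4 : p % 4 = 3 := by omega
  have key := jacobiSym_two_mul_eq_of_mul_eq h
  rw [jacobiSym.at_two hdodd, jacobiSym.at_neg_one hdodd, ZMod.χ₄_nat_three_mod_four (by omega),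
    ZMod.χ₈_nat_eq_if_mod_eight] at key
  rw [jacobiSym.neg _ hpodd, ZMod.χ₄_nat_three_mod_four hp4,
      jacobiSym.quadratic_reciprocity_three_mod_four (by omega) hp4]
  rw [if_neg (by omega), if_neg (by omega)] at key
  linarith

theorem not_isSumOfThreeSquares_of_mod_eight_eq_seven {n : ℕ} (hn : n % 8 = 7) :
    ¬ IsSumOfThreeSquares n := by
  rintro ⟨x, y, z, h⟩
  have h8 : ((n : ℤ) : ZMod 8) = 7 := by
    rw [Int.cast_natCast, ← ZMod.natCast_mod, hn]; rfl
  rw [h] at h8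
  push_cast at h8
  generalize (x : ZMod 8) = x at h8
  generalize (y : ZMod 8) = y at h8
  generalize (z : ZMod 8) = z at h8
  revert x y z
  decide

theorem isSumOfThreeSquares_four_mul_iff (n : ℕ) :
    IsSumOfThreeSquares (4 * n) ↔ IsSumOfThreeSquares n := by
  constructor
  · rintro ⟨x, y, z, h⟩
    push_cast at h
    -- Squares are `0` or `1` modulo `4`, so all three are even.
    obtain ⟨x, rfl | rfl⟩ : ∃ x', x = 2 * x' ∨ x = 2 * x' + 1 := ⟨x / 2, by omega⟩ <;>
    obtain ⟨y, rfl | rfl⟩ : ∃ y', y = 2 * y' ∨ y = 2 * y' + 1 := ⟨y / 2, by omega⟩ <;>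
    obtain ⟨z, rfl | rfl⟩ : ∃ z', z = 2 * z' ∨ z = 2 * z' + 1 := ⟨z / 2, by omega⟩ <;>
    ring_nf at h <;> first
      | exact ⟨x, y, z, by linarith⟩
      | omega
  · rintro ⟨x, y, z, h⟩
    exact ⟨2 * x, 2 * y, 2 * z, by push_cast; rw [h]; ring⟩

/-- The three squares theorem of Legendre and Gauss for numbers that are not divisible by `4`. -/
theorem isSumOfThreeSquares_iff_of_mod_four_ne_zero {n : ℕ} (hn : n % 4 ≠ 0) :
    IsSumOfThreeSquares n ↔ n % 8 ≠ 7 := by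
  refine ⟨fun h h7 => not_isSumOfThreeSquares_of_mod_eight_eq_seven h7 h, fun h => ?_⟩
  have : n % 4 = 2 ∨ n % 8 = 1 ∨ n % 8 = 3 ∨ n % 8 = 5 := by omega
  rcases this with h | h | h | h
  · exact isSumOfThreeSquares_of_mod_four_eq_two h
  · exact isSumOfThreeSquares_of_mod_eight_eq_one h
  · exact isSumOfThreeSquares_of_mod_eight_eq_three h
  · exact isSumOfThreeSquares_of_mod_eight_eq_five h

/-- If `16` does not divide `n`, the exceptional numbers `4 ^ a (8 b + 7)` only occur with `a ≤ 1`. -/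
theorem isSumOfThreeSquares_iff_of_mod_sixteen_ne_zero {n : ℕ} (hn : n % 16 ≠ 0) :
    IsSumOfThreeSquares n ↔ n % 8 ≠ 7 ∧ n % 32 ≠ 28 := by
  by_cases h4 : n % 4 = 0
  · obtain ⟨m, rfl⟩ := Nat.dvd_of_mod_eq_zero h4
    rw [isSumOfThreeSquares_four_mul_iff, isSumOfThreeSquares_iff_of_mod_four_ne_zero (by omega)]
    omega
  · rw [isSumOfThreeSquares_iff_of_mod_four_ne_zero h4]
    omega

/-! ### The Prouhet–Thue–Morse sequence -/

@[simp]
theorem thueMorse_zero : thueMorse 0 = 1 := by simp [thueMorse]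

@[simp]
theorem thueMorse_two_mul (n : ℕ) : thueMorse (2 * n) = thueMorse n := by
  rcases n.eq_zero_or_pos with rfl | hn
  · rfl
  · rw [thueMorse, thueMorse, Nat.digits_def' one_lt_two (by omega)]
    simp

@[simp]
theorem thueMorse_two_mul_add_one (n : ℕ) : thueMorse (2 * n + 1) = -thueMorse n := by
  rw [thueMorse, thueMorse, Nat.digits_def' one_lt_two (by omega)]
  have h1 : (2 * n + 1) % 2 = 1 := by omega
  have h2 : (2 * n + 1) / 2 = n := by omega
  rw [h1, h2, List.sum_cons, pow_add]
  ring

theorem thueMorse_eq_or (n : ℕ) : thueMorse n = 1 ∨ thueMorse n = -1 :=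
  neg_one_pow_eq_or ℤ _

theorem thueMorse_two_pow_mul_add (e a : ℕ) {r : ℕ} (hr : r < 2 ^ e) :
    thueMorse (2 ^ e * a + r) = thueMorse a * thueMorse r := by
  induction e generalizing r with
  | zero => obtain rfl : r = 0 := by simpa using hr
            simp
  | succ e ih =>
    rw [pow_succ] at hr
    obtain ⟨s, rfl | rfl⟩ : ∃ s, r = 2 * s ∨ r = 2 * s + 1 := ⟨r / 2, by omega⟩
    · have : 2 ^ (e + 1) * a + 2 * s = 2 * (2 ^ e * a + s) := by ring
      rw [this, thueMorse_two_mul, thueMorse_two_mul, ih (by omega)]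
    · have : 2 ^ (e + 1) * a + (2 * s + 1) = 2 * (2 ^ e * a + s) + 1 := by ring
      rw [this, thueMorse_two_mul_add_one, thueMorse_two_mul_add_one, ih (by omega)]
      ring

/-- Passing from `n` to `n + 1` turns a block of `ν₂ (n + 1)` trailing ones into zeros and the zero
before it into a one. -/
theorem thueMorse_succ_eq_iff (n : ℕ) :
    thueMorse (n + 1) = thueMorse n ↔ Odd (padicValNat 2 (n + 1)) := by
  induction n using Nat.strong_induction_on with
  | _ n ih =>
    obtain ⟨m, rfl | rfl⟩ : ∃ m, n = 2 * m ∨ n = 2 * m + 1 := ⟨n / 2, by omega⟩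
    · have : padicValNat 2 (2 * m + 1) = 0 := padicValNat.eq_zero_of_not_dvd (by omega)
      rw [this, thueMorse_two_mul_add_one, thueMorse_two_mul]
      rcases thueMorse_eq_or m with h | h <;> rw [h] <;> decide
    · have h1 : 2 * m + 1 + 1 = 2 * (m + 1) := by ring
      have h2 : padicValNat 2 (2 * (m + 1)) = padicValNat 2 (m + 1) + 1 := by
        rw [padicValNat.mul (by norm_num) (by omega), padicValNat_self, add_comm]
      rw [h1, h2, thueMorse_two_mul, thueMorse_two_mul_add_one, Nat.odd_add_one, ← ih m (by omega)]
      rcases thueMorse_eq_or m with h | h <;> rcases thueMorse_eq_or (m + 1) with h' | h' <;>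
        rw [h, h'] <;> decide

/-! ### Generating functions -/

open PowerSeries Finset

/-- The generating function of the Prouhet–Thue–Morse sequence. -/
noncomputable def thueMorseSeries : ℤ⟦X⟧ := PowerSeries.mk thueMorse

/-- The generating function of the binary partition function. -/
noncomputable def binaryPartitionSeries : ℤ⟦X⟧ := PowerSeries.mk fun n => (binaryPartition n : ℤ)

theorem coeff_binaryPartitionSeries_pow (m n : ℕ) :
    coeff n (binaryPartitionSeries ^ m) = (colouredBinaryPartition m n : ℤ) := by
  have h : binaryPartitionSeries ^ m = ∏ _j : Fin m, binaryPartitionSeries := by simp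
  rw [h, coeff_prod, colouredBinaryPartition, Nat.cast_sum]
  refine Finset.sum_bij' (fun l _ => ⇑l) (fun i _ => Finsupp.equivFunOnFinite.symm i) ?_ ?_ ?_ ?_ ?_
  · intro l hl
    simpa [Finset.Nat.mem_antidiagonalTuple] using hl
  · intro l hl
    simpa [Finset.Nat.mem_antidiagonalTuple] using hl
  · intro l _; ext; simp
  · intro l _; ext; simp
  · intro l _
    simp [binaryPartitionSeries]

/-- The partial products of `∏ (1 - X ^ 2 ^ a)` are truncations of the Thue–Morse series. -/
theorem coeff_prod_one_sub_X_pow (N n : ℕ) :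
    coeff n (∏ a ∈ range N, (1 - X ^ 2 ^ a) : ℤ⟦X⟧) = if n < 2 ^ N then thueMorse n else 0 := by
  induction N generalizing n with
  | zero =>
    rcases n.eq_zero_or_pos with rfl | hn
    · simp
    · simp [coeff_one, hn.ne']
  | succ N ih =>
    rw [prod_range_succ, mul_sub, mul_one, map_sub, coeff_mul_X_pow', ih, ih, pow_succ]
    by_cases h : 2 ^ N ≤ n
    · rw [if_neg (by omega), if_pos h]
      obtain ⟨r, rfl⟩ := Nat.exists_eq_add_of_le h
      by_cases hr : r < 2 ^ N
      · rw [if_pos (by omega), if_pos (by omega)]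
        have := thueMorse_two_pow_mul_add N 1 hr
        have h1 : thueMorse 1 = -1 := thueMorse_two_mul_add_one 0
        rw [mul_one, h1] at this
        rw [this]; simp
      · rw [if_neg (by omega), if_neg (by omega)]; simp
    · rw [if_pos (by omega), if_neg h, if_pos (by omega), sub_zero]

section Topology

open scoped PowerSeries.WithPiTopology
open Filter

theorem hasProd_thueMorseSeries :
    HasProd (fun a : ℕ => (1 - X ^ 2 ^ a : ℤ⟦X⟧)) thueMorseSeries := by
  have hm : Multipliable (fun a : ℕ => (1 - X ^ 2 ^ a : ℤ⟦X⟧)) := by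
    simp_rw [sub_eq_add_neg]
    refine WithPiTopology.multipliable_one_add_of_tendsto_order_atTop_nhds_top _ ?_
    refine ENat.tendsto_nhds_top_iff_natCast_lt.mpr fun n => eventually_atTop.mpr ⟨n, fun m hm => ?_⟩
    rw [order_neg, order_X_pow]
    exact_mod_cast hm.trans_lt Nat.lt_two_pow_self
  have h := hm.hasProd
  have h1 := h.tendsto_prod_nat
  have h2 : Tendsto (fun N => (∏ a ∈ range N, (1 - X ^ 2 ^ a) : ℤ⟦X⟧)) atTop
      (nhds thueMorseSeries) := by
    rw [WithPiTopology.tendsto_iff_coeff_tendsto]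
    intro d
    refine tendsto_atTop_of_eventually_const (i₀ := d) fun N hN => ?_
    rw [coeff_prod_one_sub_X_pow, if_pos (lt_of_le_of_lt hN Nat.lt_two_pow_self), thueMorseSeries,
      coeff_mk]
  rw [← tendsto_nhds_unique h1 h2]
  exact h

theorem hasProd_binaryPartitionSeries :
    HasProd (fun a : ℕ => (∑' j : ℕ, X ^ (2 ^ a * j) : ℤ⟦X⟧)) binaryPartitionSeries := by
  have h := Nat.Partition.hasProd_powerSeriesMk_card_restricted ℤ Nat.isPowerOfTwo
  have hinj : Function.Injective (fun a : ℕ => 2 ^ a - 1) := by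
    intro a b hab
    have ha := Nat.one_le_two_pow (n := a)
    have hb := Nat.one_le_two_pow (n := b)
    exact Nat.pow_right_injective le_rfl (show 2 ^ a = 2 ^ b by simp only at hab; omega)
  rw [← hinj.hasProd_iff] at h
  · convert! h using 2 with a
    have ha := Nat.one_le_two_pow (n := a)
    simp only [Function.comp, Nat.sub_add_cancel ha]
    rw [if_pos ⟨a, rfl⟩]
  · intro i hi
    rw [if_neg]
    rintro ⟨a, ha⟩
    exact hi ⟨a, by simp only; omega⟩

theorem binaryPartitionSeries_mul_thueMorseSeries :
    binaryPartitionSeries * thueMorseSeries = 1 := by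
  have h := hasProd_binaryPartitionSeries.mul hasProd_thueMorseSeries
  refine h.unique ?_
  convert! hasProd_one with a
  simp only [pow_mul]
  exact WithPiTopology.tsum_pow_mul_one_sub_of_constantCoeff_eq_zero (by simp)

end Topology

/-! ### Congruences between power series -/

theorem PowerSeries.natCast_dvd_iff (d : ℕ) (f : ℤ⟦X⟧) :
    (d : ℤ⟦X⟧) ∣ f ↔ ∀ n, (d : ℤ) ∣ coeff n f := by
  rw [← map_natCast (C (R := ℤ))]
  constructor
  · rintro ⟨g, rfl⟩ n
    rw [coeff_C_mul]
    exact dvd_mul_right _ _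
  · intro h
    choose g hg using h
    exact ⟨PowerSeries.mk g, by ext n; rw [coeff_C_mul, coeff_mk, hg]⟩

/-- Freshman's dream for integral power series modulo `2`: a square is congruent to the series
obtained by substituting `X ^ 2`. -/
theorem PowerSeries.two_dvd_sq_sub_expand (f : ℤ⟦X⟧) :
    (2 : ℤ⟦X⟧) ∣ f ^ 2 - PowerSeries.expand 2 two_ne_zero f := by
  have h : PowerSeries.map (Int.castRingHom (ZMod 2))
      (f ^ 2 - PowerSeries.expand 2 two_ne_zero f) = 0 := by
    rw [map_sub, map_pow, map_expand, sub_eq_zero]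
    have := MvPowerSeries.map_frobenius_expand 2 two_ne_zero
      (f := PowerSeries.map (Int.castRingHom (ZMod 2)) f)
    rw [ZMod.frobenius_zmod, MvPowerSeries.map_id] at this
    exact this.symm
  refine (natCast_dvd_iff 2 _).mpr fun n => ?_
  have := congrArg (coeff n) h
  rw [coeff_map, map_zero] at this
  exact (ZMod.intCast_zmod_eq_zero_iff_dvd _ 2).mp (by simpa using this)

/-- With `T` the Thue–Morse series, `(1 + X) T = 1 + 2 u`, where `u + u² ≡ X² / (1 + X²)` modulo `2`.
Modulo `2` the square `u²` is `u(X²)`, so the second claim is a statement about the coefficients of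
`u`, which are half-sums of neighbouring Thue–Morse values. -/
theorem exists_one_add_X_mul_thueMorseSeries :
    ∃ u : ℤ⟦X⟧, (1 + X) * thueMorseSeries = 1 + 2 * u ∧
      (2 : ℤ⟦X⟧) ∣ (1 + X ^ 2) * (u + u ^ 2) - X ^ 2 := by
  -- For `n = 2 m` with `m > 0` the coefficient is half of `t (2 m) + t (2 m - 1)`.
  let v : ℕ → ℤ := fun m => if m = 0 then 0 else (thueMorse m - thueMorse (m - 1)) / 2
  let u : ℤ⟦X⟧ := PowerSeries.mk fun n => if 2 ∣ n then v (n / 2) else 0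
  have hv (m : ℕ) : 2 * v (m + 1) = thueMorse (m + 1) - thueMorse m := by
    simp only [v, Nat.add_sub_cancel, Nat.succ_ne_zero, if_false]
    rcases thueMorse_eq_or m with h | h <;> rcases thueMorse_eq_or (m + 1) with h' | h' <;>
      rw [h, h'] <;> rfl
  have h1 : (1 + X) * thueMorseSeries = 1 + 2 * u := by
    ext n
    rw [add_mul, one_mul, map_add, map_add, two_mul, map_add]
    rcases n with _ | n
    · simp [thueMorseSeries, u, v]
    · rw [coeff_succ_X_mul]
      simp only [thueMorseSeries, coeff_mk, u, coeff_one, Nat.succ_ne_zero, if_false]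
      obtain ⟨m, rfl | rfl⟩ : ∃ m, n = 2 * m ∨ n = 2 * m + 1 := ⟨n / 2, by omega⟩
      · rw [if_neg (by omega), thueMorse_two_mul, thueMorse_two_mul_add_one]
        ring
      · have e : 2 * m + 1 + 1 = 2 * (m + 1) := by ring
        rw [e, if_pos (dvd_mul_right _ _), Nat.mul_div_cancel_left _ two_pos, thueMorse_two_mul,
          thueMorse_two_mul_add_one]
        linarith [hv m]
  refine ⟨u, h1, ?_⟩
  have h2 : (2 : ℤ⟦X⟧) ∣ (1 + X ^ 2) * (u + PowerSeries.expand 2 two_ne_zero u) - X ^ 2 := by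
    -- All coefficients of `u + u(X²)` at positive even exponents are odd.
    have key (n : ℕ) : (2 : ℤ) ∣ coeff n (u + PowerSeries.expand 2 two_ne_zero u)
        - if 2 ∣ n ∧ n ≠ 0 then 1 else 0 := by
      rw [map_add, coeff_expand]
      simp only [u, coeff_mk]
      by_cases hn : 2 ∣ n
      · obtain ⟨m, rfl⟩ := hn
        simp only [dvd_mul_right, if_true, true_and, Nat.mul_div_cancel_left _ two_pos]
        rcases m with _ | m
        · simp [v]
        · rw [if_pos (show 2 * (m + 1) ≠ 0 by omega)]
          have := hv m
          obtain ⟨j, rfl | rfl⟩ : ∃ j, m = 2 * j ∨ m = 2 * j + 1 := ⟨m / 2, by omega⟩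
          · rw [if_neg (by omega)]
            rw [thueMorse_two_mul, thueMorse_two_mul_add_one] at this
            rcases thueMorse_eq_or j with h | h <;> rw [h] at this <;> omega
          · have e : 2 * j + 1 + 1 = 2 * (j + 1) := by ring
            rw [e] at this ⊢
            rw [if_pos (dvd_mul_right _ _), Nat.mul_div_cancel_left _ two_pos]
            rw [thueMorse_two_mul, thueMorse_two_mul_add_one] at this
            have h' := hv j
            rcases thueMorse_eq_or j with h | h <;> rcases thueMorse_eq_or (j + 1) with h' | h' <;>
              simp only [h, h'] at * <;> omega
      · simp [hn]
    refine (natCast_dvd_iff 2 _).mpr fun n => ?_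
    have k0 := key n
    rw [add_mul, one_mul, map_sub, map_add, coeff_X_pow_mul', coeff_X_pow]
    by_cases hn : 2 ≤ n
    · have k2 := key (n - 2)
      rw [if_pos hn]
      push_cast
      split_ifs at k0 k2 ⊢ <;> omega
    · rw [if_neg hn, if_neg (by omega)]
      rw [if_neg (by omega)] at k0
      simpa using k0
  have h3 := dvd_mul_of_dvd_right (two_dvd_sq_sub_expand u) (1 + X ^ 2)
  have := dvd_add h2 h3
  convert this using 1
  ring

theorem binaryPartitionSeries_pow_sub_one (k : ℕ) :
    binaryPartitionSeries ^ (2 ^ k - 1) = thueMorseSeries * binaryPartitionSeries ^ 2 ^ k := by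
  obtain ⟨j, hj⟩ : ∃ j, 2 ^ k = j + 1 := ⟨2 ^ k - 1, by have := Nat.one_le_two_pow (n := k); omega⟩
  rw [hj, Nat.add_sub_cancel, pow_succ]
  linear_combination (-binaryPartitionSeries ^ j) * binaryPartitionSeries_mul_thueMorseSeries

theorem two_dvd_binaryPartitionSeries_sub : (2 : ℤ⟦X⟧) ∣ binaryPartitionSeries - (1 + X) := by
  obtain ⟨u, hu, -⟩ := exists_one_add_X_mul_thueMorseSeries
  refine ⟨-u * binaryPartitionSeries, ?_⟩
  linear_combination (1 + X) * binaryPartitionSeries_mul_thueMorseSeries -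
    binaryPartitionSeries * hu

theorem two_dvd_binaryPartitionSeries_two_pow_sub (j : ℕ) :
    (2 : ℤ⟦X⟧) ∣ binaryPartitionSeries ^ 2 ^ j - (1 + X ^ 2 ^ j) := by
  induction j with
  | zero => simpa using two_dvd_binaryPartitionSeries_sub
  | succ j ih =>
    have h1 := dvd_mul_of_dvd_left ih (binaryPartitionSeries ^ 2 ^ j + (1 + X ^ 2 ^ j))
    have h2 := dvd_add h1 (dvd_mul_right 2 (X ^ 2 ^ j))
    convert h2 using 1
    rw [pow_succ, pow_mul, pow_mul]
    ring

/-- The congruence modulo `2` between `B ^ 2 ^ j` and `1 + X ^ 2 ^ j` gains one power of `2` with each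
squaring. -/
theorem two_pow_dvd_coeff_sub (j i n : ℕ) :
    (2 : ℤ) ^ (i + 1) ∣ colouredBinaryPartition (2 ^ (j + i) - 1) n -
      coeff n (thueMorseSeries * (1 + X ^ 2 ^ j) ^ 2 ^ i) := by
  have h := dvd_sub_pow_of_dvd_sub (R := ℤ⟦X⟧) (p := 2)
    (by exact_mod_cast two_dvd_binaryPartitionSeries_two_pow_sub j) i
  have h1 := dvd_mul_of_dvd_right h thueMorseSeries
  rw [← pow_mul, ← pow_add, mul_sub, ← binaryPartitionSeries_pow_sub_one, ← Nat.cast_pow,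
    natCast_dvd_iff] at h1
  have h2 := h1 n
  rw [map_sub, coeff_binaryPartitionSeries_pow] at h2
  exact_mod_cast h2

/-- For seven colours `two_pow_dvd_coeff_sub` only gives a congruence modulo `16`. Modulo `32` the
difference of the two generating functions is the polynomial `-16 X² (1 + X)⁵` of degree `7`, which
does not reach the coefficients considered here. -/
theorem thirtyTwo_dvd_coeff_seven_sub {n : ℕ} (hn : 8 ≤ n) :
    (32 : ℤ) ∣ colouredBinaryPartition 7 n - coeff n (thueMorseSeries * (1 + X) ^ 8) := by
  obtain ⟨u, hu, w, hw⟩ := exists_one_add_X_mul_thueMorseSeries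
  obtain ⟨s, hs⟩ := two_dvd_binaryPartitionSeries_sub
  have hBT := binaryPartitionSeries_mul_thueMorseSeries
  have hB8 := binaryPartitionSeries_pow_sub_one 3
  norm_num at hB8
  have h7 : (2 : ℤ⟦X⟧) ∣ binaryPartitionSeries ^ 7 - (1 + X) ^ 7 :=
    (Dvd.intro _ hs.symm).trans (sub_dvd_pow_sub_pow _ _ 7)
  obtain ⟨r, hr⟩ := h7
  generalize hB : binaryPartitionSeries = B at *
  generalize thueMorseSeries = T at *
  -- `(1 + 2 u) ^ 8` is `1 + 16 (u + u²)` modulo `32`.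
  obtain ⟨e, he⟩ : ∃ e, (1 + 2 * u) ^ 8 = 1 + 16 * (u + u ^ 2) + 32 * e :=
    ⟨3 * u ^ 2 + 14 * u ^ 3 + 35 * u ^ 4 + 56 * u ^ 5 + 56 * u ^ 6 + 32 * u ^ 7 + 8 * u ^ 8, by ring⟩
  have h1 : T * (1 + X) ^ 8 = B ^ 7 * (1 + 16 * (u + u ^ 2) + 32 * e) := by
    rw [← he, ← hu, hB8, mul_pow]
    have h8 : B ^ 8 * T ^ 8 = 1 := by rw [← mul_pow, hBT, one_pow]
    linear_combination (-T * (1 + X) ^ 8) * h8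
  have h2 : ∃ g : ℤ⟦X⟧, B ^ 7 * (u + u ^ 2) = X ^ 2 * (1 + X) ^ 5 + 2 * g :=
    ⟨r * (u + u ^ 2) + (1 + X) ^ 5 * w + (1 + X) ^ 5 * X * (u + u ^ 2), by
      linear_combination (u + u ^ 2) * hr + (1 + X) ^ 5 * hw⟩
  obtain ⟨g, hg⟩ := h2
  have h3 : B ^ 7 - T * (1 + X) ^ 8 =
      C (-16 : ℤ) * (X ^ 2 * (1 + X) ^ 5) + ((32 : ℕ) : ℤ⟦X⟧) * (-(g + B ^ 7 * e)) := by
    rw [map_neg, map_ofNat]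
    push_cast
    linear_combination -h1 - 16 * hg
  have h4 := congrArg (coeff n) h3
  have h5 : coeff n (X ^ 2 * (1 + X) ^ 5 : ℤ⟦X⟧) = 0 := by
    have : (X ^ 2 * (1 + X) ^ 5 : ℤ⟦X⟧)
        = ((Polynomial.X ^ 2 * (1 + Polynomial.X) ^ 5 : Polynomial ℤ) : ℤ⟦X⟧) := by simp
    rw [this, Polynomial.coeff_coe]
    refine Polynomial.coeff_eq_zero_of_natDegree_lt (lt_of_le_of_lt ?_ hn)
    compute_degree
  rw [map_sub, map_add, ← hB, coeff_binaryPartitionSeries_pow, coeff_C_mul, h5, mul_zero,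
    zero_add] at h4
  rw [h4]
  exact (natCast_dvd_iff 32 _).mp (dvd_mul_right _ _) n

/-! ### Coefficients modulo `8` and `32` -/

theorem coeff_thueMorseSeries_mul_one_add_X_pow_pow (d N n : ℕ) :
    coeff n (thueMorseSeries * (1 + X ^ d) ^ N) =
      ∑ i ∈ range (N + 1), (N.choose i : ℤ) * if d * i ≤ n then thueMorse (n - d * i) else 0 := by
  rw [add_comm, add_pow, mul_sum, map_sum]
  refine sum_congr rfl fun i _ => ?_
  rw [one_pow, mul_one, ← pow_mul, mul_comm _ (N.choose i : ℤ⟦X⟧), mul_left_comm,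
    ← map_natCast (C (R := ℤ)), coeff_C_mul, coeff_mul_X_pow']
  simp [thueMorseSeries]

/-- The part of `∑ i, C(N, i) t (N m + l - i)` with `i ≤ l`, divided by `t m`. -/
def binomThueMorseLow (N l : ℕ) : ℤ :=
  ∑ i ∈ range (l + 1), (N.choose i : ℤ) * thueMorse (l - i)

/-- The part of `∑ i, C(N, i) t (N m + l - i)` with `l < i ≤ N`, divided by `t (m - 1)`. -/
def binomThueMorseHigh (N l : ℕ) : ℤ :=
  ∑ i ∈ Ico (l + 1) (N + 1), (N.choose i : ℤ) * thueMorse (N + l - i)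

theorem coeff_thueMorseSeries_mul_eq {a j m l r : ℕ} (hl : l < 2 ^ a) (hr : r < 2 ^ j) :
    coeff (2 ^ j * (2 ^ a * m + l) + r) (thueMorseSeries * (1 + X ^ 2 ^ j) ^ 2 ^ a) =
      thueMorse r * (thueMorse m * binomThueMorseLow (2 ^ a) l +
        (if m = 0 then 0 else thueMorse (m - 1)) * binomThueMorseHigh (2 ^ a) l) := by
  rw [coeff_thueMorseSeries_mul_one_add_X_pow_pow,
    ← sum_range_add_sum_Ico _ (show l + 1 ≤ 2 ^ a + 1 by omega), mul_add (thueMorse r)]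
  have hsub {i : ℕ} (hi : i ≤ 2 ^ a * m + l) :
      2 ^ j * (2 ^ a * m + l) + r - 2 ^ j * i = 2 ^ j * (2 ^ a * m + l - i) + r := by
    have := Nat.mul_le_mul_left (2 ^ j) hi
    rw [Nat.mul_sub]; omega
  congr 1
  · rw [binomThueMorseLow, mul_sum, mul_sum]
    refine sum_congr rfl fun i hi => ?_
    have hil : i ≤ l := by simpa [Nat.lt_succ_iff] using hi
    have hi' : i ≤ 2 ^ a * m + l := by omega
    rw [if_pos ((Nat.mul_le_mul_left _ hi').trans (Nat.le_add_right _ _)), hsub hi',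
      thueMorse_two_pow_mul_add _ _ hr, Nat.add_sub_assoc hil,
      thueMorse_two_pow_mul_add _ _ (by omega)]
    ring
  · rw [binomThueMorseHigh, mul_sum, mul_sum]
    refine sum_congr rfl fun i hi => ?_
    obtain ⟨hi1, hi2⟩ := mem_Ico.mp hi
    rcases m with _ | m
    · rw [if_neg, if_pos rfl]
      · ring
      · rw [mul_zero, zero_add]
        intro h
        have := Nat.mul_le_mul_left (2 ^ j) hi1
        rw [mul_add] at this
        omega
    · have hsplit : 2 ^ a * (m + 1) + l - i = 2 ^ a * m + (2 ^ a + l - i) := by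
        rw [mul_add, mul_one]; omega
      have hi' : i ≤ 2 ^ a * (m + 1) + l := by rw [mul_add, mul_one]; omega
      rw [if_pos ((Nat.mul_le_mul_left _ hi').trans (Nat.le_add_right _ _)), hsub hi',
        thueMorse_two_pow_mul_add _ _ hr, hsplit, thueMorse_two_pow_mul_add _ _ (by omega),
        if_neg (by omega), Nat.add_sub_cancel]
      ring

/-- With `binomThueMorse_sixteen`, the finite computation behind the case `2 ^ k ≤ n`: equal signs
`t m = t (m - 1)` give a coefficient `± 28` modulo `32`, opposite signs one that is `2` modulo `4`. -/
theorem binomThueMorse_eight {l : ℕ} (hl : l < 8) :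
    (binomThueMorseLow 8 l + binomThueMorseHigh 8 l - 28 * thueMorse l) % 32 = 0 ∧
      (binomThueMorseLow 8 l - binomThueMorseHigh 8 l) % 4 = 2 := by
  revert l
  decide +kernel

theorem binomThueMorse_sixteen {l : ℕ} (hl : l < 16) :
    (binomThueMorseLow 16 l + binomThueMorseHigh 16 l - 28 * thueMorse l) % 32 = 0 ∧
      (binomThueMorseLow 16 l - binomThueMorseHigh 16 l) % 4 = 2 := by
  revert l
  decide +kernel

/-- The residue modulo `32` of the number of partitions in `2 ^ k - 1` colours is governed by a
coefficient with exponent `8` for `k = 3` and exponent `16` for larger `k`. -/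
theorem exists_colouredBinaryPartition_modEq {k m L : ℕ} (hk : 3 ≤ k) (hL : L < 2 ^ k) :
    ∃ A B : ℤ, (32 : ℤ) ∣ colouredBinaryPartition (2 ^ k - 1) (2 ^ k * (m + 1) + L) -
        (thueMorse (m + 1) * A + thueMorse m * B) ∧
      (A + B - 28 * thueMorse L) % 32 = 0 ∧ (A - B) % 4 = 2 := by
  obtain ⟨j, a, l, hja, hcong, hl, hfin⟩ : ∃ j a l, k = j + a ∧
      (32 : ℤ) ∣ colouredBinaryPartition (2 ^ k - 1) (2 ^ k * (m + 1) + L) -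
        coeff (2 ^ k * (m + 1) + L) (thueMorseSeries * (1 + X ^ 2 ^ j) ^ 2 ^ a) ∧
      l = L / 2 ^ j ∧
      (binomThueMorseLow (2 ^ a) l + binomThueMorseHigh (2 ^ a) l - 28 * thueMorse l) % 32 = 0 ∧
      (binomThueMorseLow (2 ^ a) l - binomThueMorseHigh (2 ^ a) l) % 4 = 2 := by
    rcases hk.eq_or_lt with rfl | hk
    · refine ⟨0, 3, L, rfl, ?_, by simp, binomThueMorse_eight hL⟩
      have := thirtyTwo_dvd_coeff_seven_sub (n := 2 ^ 3 * (m + 1) + L) (by omega)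
      simpa using this
    · obtain ⟨j, rfl⟩ := Nat.exists_eq_add_of_le' hk
      refine ⟨j, 4, L / 2 ^ j, rfl, two_pow_dvd_coeff_sub j 4 _, rfl, binomThueMorse_sixteen ?_⟩
      exact Nat.div_lt_of_lt_mul (by rwa [pow_add] at hL)
  subst hja
  have hl' : l < 2 ^ a := by
    rw [hl]; exact Nat.div_lt_of_lt_mul (by rwa [pow_add] at hL)
  have hr : L % 2 ^ j < 2 ^ j := Nat.mod_lt _ (by positivity)
  have hLeq : L = 2 ^ j * l + L % 2 ^ j := by rw [hl, Nat.div_add_mod]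
  have hn : 2 ^ (j + a) * (m + 1) + L = 2 ^ j * (2 ^ a * (m + 1) + l) + L % 2 ^ j := by
    conv_lhs => rw [hLeq]
    rw [pow_add]; ring
  have htL : thueMorse L = thueMorse l * thueMorse (L % 2 ^ j) := by
    conv_lhs => rw [hLeq]
    exact thueMorse_two_pow_mul_add _ _ hr
  refine ⟨thueMorse (L % 2 ^ j) * binomThueMorseLow (2 ^ a) l,
    thueMorse (L % 2 ^ j) * binomThueMorseHigh (2 ^ a) l, ?_, ?_⟩
  · convert hcong using 2
    conv_rhs => rw [hn]
    rw [coeff_thueMorseSeries_mul_eq hl' hr, if_neg (by omega), Nat.add_sub_cancel]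
    ring
  · rw [htL]
    rcases thueMorse_eq_or (L % 2 ^ j) with h | h <;> rw [h] <;> omega

theorem not_isSumOfThreeSquares_colouredBinaryPartition_iff {k m L : ℕ} (hk : 3 ≤ k)
    (hL : L < 2 ^ k) :
    ¬ IsSumOfThreeSquares (colouredBinaryPartition (2 ^ k - 1) (2 ^ k * (m + 1) + L)) ↔
      thueMorse (m + 1) = thueMorse m ∧ thueMorse (m + 1) = thueMorse L := by
  obtain ⟨A, B, h, hA, hB⟩ := exists_colouredBinaryPartition_modEq (m := m) hk hL
  generalize colouredBinaryPartition (2 ^ k - 1) (2 ^ k * (m + 1) + L) = N at *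
  have key : N % 16 ≠ 0 ∧ ((N % 8 = 7 ∨ N % 32 = 28) ↔
      thueMorse (m + 1) = thueMorse m ∧ thueMorse (m + 1) = thueMorse L) := by
    rcases thueMorse_eq_or (m + 1) with h1 | h1 <;> rcases thueMorse_eq_or m with h2 | h2 <;>
      rcases thueMorse_eq_or L with h3 | h3 <;> rw [h1, h2] at h <;> rw [h3] at hA <;>
      rw [h1, h2, h3] <;> omega
  rw [isSumOfThreeSquares_iff_of_mod_sixteen_ne_zero key.1, ← key.2]
  omega

/-- The finite computation behind the case `n < 2 ^ k`: only the first and the third quarter can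
produce the residue `7` modulo `8`, and only for `t r = -1`. -/
theorem binomThueMorseLow_four {l : ℕ} (hl : l < 4) :
    (binomThueMorseLow 4 l - 7) % 8 ≠ 0 ∧
      ((-binomThueMorseLow 4 l - 7) % 8 = 0 ↔ l = 0 ∨ l = 2) ∧
      binomThueMorseLow 4 l % 2 = 1 ∧ (thueMorse l = if l = 0 ∨ l = 3 then 1 else -1) := by
  revert l
  decide +kernel

theorem not_isSumOfThreeSquares_colouredBinaryPartition_iff_of_lt {j n : ℕ}
    (hn : n < 2 ^ (j + 2)) :
    ¬ IsSumOfThreeSquares (colouredBinaryPartition (2 ^ (j + 2) - 1) n) ↔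
      (n / 2 ^ j = 0 ∨ n / 2 ^ j = 2) ∧ thueMorse (n % 2 ^ j) = -1 := by
  have hr : n % 2 ^ j < 2 ^ j := Nat.mod_lt _ (by positivity)
  have hl : n / 2 ^ j < 2 ^ 2 := Nat.div_lt_of_lt_mul (by rwa [pow_add] at hn)
  have h := two_pow_dvd_coeff_sub j 2 n
  have hc := coeff_thueMorseSeries_mul_eq (m := 0) hl hr
  rw [mul_zero, zero_add, Nat.div_add_mod, if_pos rfl, thueMorse_zero] at hc
  rw [hc] at h
  generalize colouredBinaryPartition (2 ^ (j + 2) - 1) n = N at *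
  obtain ⟨h1, h2, h3, -⟩ := binomThueMorseLow_four hl
  generalize n / 2 ^ j = l at *
  norm_num at h
  generalize binomThueMorseLow 4 l = A at *
  have h4 : N % 4 ≠ 0 := by
    rcases thueMorse_eq_or (n % 2 ^ j) with e | e <;> rw [e] at h <;> omega
  rw [isSumOfThreeSquares_iff_of_mod_four_ne_zero h4, not_not, ← h2]
  rcases thueMorse_eq_or (n % 2 ^ j) with e | e <;> rw [e] at h ⊢ <;> omega

theorem mainTheorem3 (k n : ℕ) (hk : 3 ≤ k) :
    (2 ^ k ≤ n →
      List.TFAE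
        [¬ IsSumOfThreeSquares (colouredBinaryPartition (2 ^ k - 1) n),
          thueMorse n = 1 ∧ thueMorse (n - 2 ^ k) = 1,
          ∃ m l : ℕ, n = 2 ^ k * m + l ∧ l < 2 ^ k ∧ thueMorse m = thueMorse l ∧
            Odd (padicValNat 2 m)]) ∧
    (n < 2 ^ k →
      (¬ IsSumOfThreeSquares (colouredBinaryPartition (2 ^ k - 1) n) ↔
        (n < 2 ^ (k - 2) ∧ thueMorse n = -1) ∨
        (2 ^ (k - 1) ≤ n ∧ n < 3 * 2 ^ (k - 2) ∧ thueMorse n = 1))) := by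
  constructor
  · intro hn
    obtain ⟨m, L, rfl, hL⟩ : ∃ m L, n = 2 ^ k * (m + 1) + L ∧ L < 2 ^ k := by
      have hpos : 0 < n / 2 ^ k := Nat.div_pos hn (by positivity)
      exact ⟨n / 2 ^ k - 1, n % 2 ^ k, by rw [Nat.sub_add_cancel hpos, Nat.div_add_mod],
        Nat.mod_lt _ (by positivity)⟩
    have hiff := not_isSumOfThreeSquares_colouredBinaryPartition_iff (m := m) hk hL
    have h12 : (thueMorse (2 ^ k * (m + 1) + L) = 1 ∧
        thueMorse (2 ^ k * (m + 1) + L - 2 ^ k) = 1) ↔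
        thueMorse (m + 1) = thueMorse m ∧ thueMorse (m + 1) = thueMorse L := by
      have : 2 ^ k * (m + 1) + L - 2 ^ k = 2 ^ k * m + L := by
        rw [mul_add, mul_one]; omega
      rw [this, thueMorse_two_pow_mul_add _ _ hL, thueMorse_two_pow_mul_add _ _ hL]
      rcases thueMorse_eq_or (m + 1) with h1 | h1 <;> rcases thueMorse_eq_or m with h2 | h2 <;>
        rcases thueMorse_eq_or L with h3 | h3 <;> rw [h1, h2, h3] <;> decide
    have h13 : (∃ m' l : ℕ, 2 ^ k * (m + 1) + L = 2 ^ k * m' + l ∧ l < 2 ^ k ∧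
        thueMorse m' = thueMorse l ∧ Odd (padicValNat 2 m')) ↔
        thueMorse (m + 1) = thueMorse m ∧ thueMorse (m + 1) = thueMorse L := by
      rw [thueMorse_succ_eq_iff]
      constructor
      · rintro ⟨m', l, he, hl, ht, hodd⟩
        have hq := congrArg (· / 2 ^ k) he
        have hr := congrArg (· % 2 ^ k) he
        simp only [Nat.mul_add_div (show 0 < 2 ^ k by positivity), Nat.div_eq_of_lt hL,
          Nat.div_eq_of_lt hl, add_zero] at hq
        simp only [Nat.mul_add_mod, Nat.mod_eq_of_lt hL, Nat.mod_eq_of_lt hl] at hr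
        subst hq hr
        exact ⟨hodd, ht⟩
      · rintro ⟨hodd, ht⟩
        exact ⟨m + 1, L, rfl, hL, ht, hodd⟩
    tfae_have 1 ↔ 2 := hiff.trans h12.symm
    tfae_have 1 ↔ 3 := hiff.trans h13.symm
    tfae_finish
  · intro hn
    obtain ⟨j, rfl⟩ := Nat.exists_eq_add_of_le' (show 2 ≤ k by omega)
    rw [not_isSumOfThreeSquares_colouredBinaryPartition_iff_of_lt hn]
    have hr : n % 2 ^ j < 2 ^ j := Nat.mod_lt _ (by positivity)
    have hl : n / 2 ^ j < 2 ^ 2 := Nat.div_lt_of_lt_mul (by rwa [pow_add] at hn)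
    have hn' : 2 ^ j * (n / 2 ^ j) + n % 2 ^ j = n := Nat.div_add_mod _ _
    have ht := thueMorse_two_pow_mul_add j (n / 2 ^ j) hr
    obtain ⟨-, -, -, htl⟩ := binomThueMorseLow_four hl
    have e1 : j + 2 - 2 = j := by omega
    have e2 : j + 2 - 1 = j + 1 := by omega
    rw [hn', htl] at ht
    rw [ht, e1, e2, pow_succ]
    generalize n / 2 ^ j = l at *
    generalize n % 2 ^ j = r at *
    generalize 2 ^ j = d at *
    interval_cases l <;> rcases thueMorse_eq_or r with h | h <;> rw [h] <;> simp <;> omega
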